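/- Let $p$ be a prime, let $\mathbb{Z}_p=\{0,\dots,p-1\}$ with arithmetic modulo $p$, and put $\omega_p=e^{2\pi i/p}$. A $p$-nary-input, $p$-nary-output (no-signalling) box is a family of probability distributions $P(a,b|x,y)$ of $(a,b)\in\mathbb{Z}_p^2$, indexed by $x,y\in\mathbb{Z}_p$, such that $\sum_b P(a,b|x,y)$ does not depend on $y$ and $\sum_a P(a,b|x,y)$ does not depend on $x$. Information causality holds for $P$ if the following is true for all integers $N,m\ge 0$. Alice holds $\vec x=(x_0,\dots,x_{N-1})$ uniformly random in $\mathbb{Z}_p^N$, and Bob holds $y\in\{0,\dots,N-1\}$. They share randomness and finitely many independent copies of $P$, whose ends each party may use adaptively (each end at most once). Alice sends Bob $m$ $p$-nary digits, after which Bob outputs $b\in\mathbb{Z}_p$. Then every such protocol satisfies $\sum_{i=0}^{N-1} I(x_i:b\,|\,y=i)\le m\log p$, where $I$ is the Shannon mutual information. A function $f:\mathbb{Z}_p\times\mathbb{Z}_p\to\mathbb{Z}_p$ is additively separable if $f(x,y)=g(x)+h(y)$ for some $g,h:\mathbb{Z}_p\to\mathbb{Z}_p$, and additively inseparable otherwise.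 Write $f(x,y)=\sum_{i,j=0}^{p-1}\lambda_{i,j}x^iy^j$ with (unique) $\lambda_{i,j}\in\mathbb{Z}_p$, and let $\Delta(f)$ be the maximum of $i+j$ over all $1\le i,j\le p-1$ with $\lambda_{i,j}\ne 0$ (and $0$ if there are none). For $x\in[0,1]$ let $h_p(x)=-x\log x-(1-x)\log(1-x)+(1-x)\log(p-1)$, and let $h_p^{-1}:[0,\log p]\to[1/p,1]$ be the inverse of the restriction of $h_p$ to $[1/p,1]$, on which $h_p$ is strictly decreasing. Theorem. Let $P$ be a $p$-nary-input, $p$-nary-output box for which information causality holds, and let $f:\mathbb{Z}_p\times\mathbb{Z}_p\to\mathbb{Z}_p$ be additively inseparable with $\Delta(f)>2$. For $j\in\mathbb{Z}_p$ let $$\nu_j=\min_{x,y\in\mathbb{Z}_p}P(a-b=f(x,y)-j\,|\,x,y)=\min_{x,y\in\mathbb{Z}_p}\sum_{k=0}^{p-1}P(a=k,\,b=k-f(x,y)+j\,|\,x,y).$$ Then the real number on the left-hand side below satisfies, for all $c\in\mathbb{Z}_p$, $$\frac1p\sum_{k=0}^{p-1}\omega_p^{ck}\Bigl(\sum_{j=0}^{p-1}\nu_j\omega_p^{jk}\Bigr)^{L/2}\Bigl(\sum_{j=0}^{p-1}\nu_j\omega_p^{-jk}\Bigr)^{L/2}\le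 h_p^{-1}\Bigl(\frac{N-1}{N}\log p\Bigr)$$ in each of the following two cases: (i) $1\le N\le p$ and $L=(N-1)2^{\Delta(f)-2}$; (ii) $N=p^n$ for some $n\ge 1$ and $L=n(p-1)2^{\Delta(f)-2}$. -/

import Mathlib

namespace FunctionalBox

noncomputable section

/-! ### Boxes -/

/-- A no-signalling box with inputs and outputs in `ZMod p`;
`prob a b x y` is the conditional probability `P(a, b | x, y)`. -/
structure Box (p : ℕ) [NeZero p] where
  prob : ZMod p → ZMod p → ZMod p → ZMod p → ℝ
  prob_nonneg : ∀ a b x y, 0 ≤ prob a b x y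
  sum_prob : ∀ x y, ∑ a, ∑ b, prob a b x y = 1
  noSignal_to_alice : ∀ a x y y', ∑ b, prob a b x y = ∑ b, prob a b x y'
  noSignal_to_bob : ∀ b x x' y, ∑ a, prob a b x y = ∑ a, prob a b x' y

/-- `E_{x,y,j} = P(a - b = f(x,y) - j | x,y)`. -/
def shiftProb {p : ℕ} [NeZero p] (P : Box p) (f : ZMod p → ZMod p → ZMod p)
    (x y j : ZMod p) : ℝ :=
  ∑ k : ZMod p, P.prob k (k - f x y + j) x y

/-- `ν_j = min_{x,y} P(a - b = f(x,y) - j | x,y)`. -/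
def nu {p : ℕ} [NeZero p] (P : Box p) (f : ZMod p → ZMod p → ZMod p) (j : ZMod p) : ℝ :=
  (Finset.univ : Finset (ZMod p × ZMod p)).inf' Finset.univ_nonempty
    (fun xy => shiftProb P f xy.1 xy.2 j)

/-! ### Bivariate functions on `ZMod p` -/

def AdditivelySeparable {p : ℕ} (f : ZMod p → ZMod p → ZMod p) : Prop :=
  ∃ g h : ZMod p → ZMod p, ∀ x y, f x y = g x + h y

theorem bijective_evalCoeffs (p : ℕ) [Fact p.Prime] :
    Function.Bijective
      (fun (c : Fin p → ZMod p) (x : ZMod p) => ∑ i : Fin p, c i * x ^ (i : ℕ)) := by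
  rw [Fintype.bijective_iff_injective_and_card]
  refine ⟨?_, by simp [ZMod.card]⟩
  have hinj : Function.Injective (fun i : Fin p => ((i : ℕ) : ZMod p)) := by
    intro i j hij
    have h := (ZMod.natCast_eq_natCast_iff' _ _ _).1 hij
    rw [Nat.mod_eq_of_lt i.2, Nat.mod_eq_of_lt j.2] at h
    exact Fin.ext h
  have hdet : (Matrix.vandermonde (fun i : Fin p => ((i : ℕ) : ZMod p))).det ≠ 0 :=
    Matrix.det_vandermonde_ne_zero_iff.2 hinj
  have hM := Matrix.mulVec_injective_iff_isUnit.2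
    ((Matrix.isUnit_iff_isUnit_det _).2 (isUnit_iff_ne_zero.2 hdet))
  intro c d hcd
  apply hM
  funext i
  have h := congrFun hcd ((i : ℕ) : ZMod p)
  simp only [Matrix.mulVec, dotProduct, Matrix.vandermonde_apply]
  simpa only [mul_comm] using h

/-- Every `f` is a polynomial of degree at most `p - 1` in each variable, in a unique way. -/
theorem existsUnique_coeffs {p : ℕ} [Fact p.Prime] (f : ZMod p → ZMod p → ZMod p) :
    ∃! l : Fin p → Fin p → ZMod p,
      ∀ x y, f x y = ∑ i : Fin p, ∑ j : Fin p, l i j * x ^ (i : ℕ) * y ^ (j : ℕ) := by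
  have hb := bijective_evalCoeffs p
  choose r hr using fun x : ZMod p => hb.2 (f x)
  choose l hl using fun j : Fin p => hb.2 (fun x => r x j)
  have key : ∀ (m : Fin p → Fin p → ZMod p) (x y : ZMod p),
      ∑ i : Fin p, ∑ j : Fin p, m i j * x ^ (i : ℕ) * y ^ (j : ℕ) =
        ∑ j : Fin p, (∑ i : Fin p, m i j * x ^ (i : ℕ)) * y ^ (j : ℕ) := by
    intro m x y
    rw [Finset.sum_comm]
    simp only [Finset.sum_mul]
  refine ⟨fun i j => l j i, ?_, ?_⟩
  · intro x y
    rw [key]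
    have h1 := congrFun (hr x) y
    simp only at h1
    rw [← h1]
    refine Finset.sum_congr rfl fun j _ => ?_
    rw [← congrFun (hl j) x]
  · intro m hm
    funext i j
    have h2 : (fun i => m i j) = l j := by
      apply hb.1
      rw [hl j]
      funext x
      have h3 : (fun j => ∑ i : Fin p, m i j * x ^ (i : ℕ)) = r x := by
        apply hb.1
        rw [hr x]
        funext y
        rw [hm x y, key]
      exact congrFun h3 j
    exact congrFun h2 i

/-- The coefficients `λ_{i,j}` of `f(x,y) = ∑_{i,j=0}^{p-1} λ_{i,j} x^i y^j`. -/
def coeffs {p : ℕ} [Fact p.Prime] (f : ZMod p → ZMod p → ZMod p) : Fin p → Fin p → ZMod p :=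
  (existsUnique_coeffs f).choose

theorem coeffs_spec {p : ℕ} [Fact p.Prime] (f : ZMod p → ZMod p → ZMod p) (x y : ZMod p) :
    f x y = ∑ i : Fin p, ∑ j : Fin p, coeffs f i j * x ^ (i : ℕ) * y ^ (j : ℕ) :=
  (existsUnique_coeffs f).choose_spec.1 x y

/-- `Δ(f)`: the maximum over `1 ≤ i, j ≤ p - 1` of `i + j` if `λ_{i,j} ≠ 0` and `0` otherwise. -/
def Delta {p : ℕ} [Fact p.Prime] (f : ZMod p → ZMod p → ZMod p) : ℕ :=
  ((Finset.univ : Finset (Fin p × Fin p)).filter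
      (fun ij => 1 ≤ (ij.1 : ℕ) ∧ 1 ≤ (ij.2 : ℕ))).sup
    (fun ij => if coeffs f ij.1 ij.2 ≠ 0 then (ij.1 : ℕ) + (ij.2 : ℕ) else 0)

/-! ### Protocols with shared randomness, boxes and one-way communication -/

/-- An adaptive strategy of one party for its ends of the boxes indexed by `ι`: either finish,
or feed `x` into box `i` and continue depending on the output obtained. -/
inductive Strategy (p : ℕ) (ι : Type) : Type
  | halt : Strategy p ι
  | use (i : ι) (x : ZMod p) (next : ZMod p → Strategy p ι) : Strategy p ι

/-- On every run, only boxes of `s` are used, each at most once. -/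
def Strategy.Valid {p : ℕ} {ι : Type} [DecidableEq ι] : Strategy p ι → Finset ι → Prop
  | .halt, _ => True
  | .use i _ next, s => i ∈ s ∧ ∀ a, (next a).Valid (s.erase i)

/-- The inputs given to the boxes when box `i` answers `out i`. A box that the strategy leaves
unused gets the dummy input `0`; by no-signalling this has no effect on the other party. -/
def Strategy.inputs {p : ℕ} {ι : Type} [DecidableEq ι] :
    Strategy p ι → (ι → ZMod p) → ι → ZMod p
  | .halt, _ => fun _ => 0
  | .use i x next, out => Function.update ((next (out i)).inputs out) i x

/-- A protocol for the task in which Alice holds `x ∈ (ZMod p)^N`, Bob holds `y ∈ {0,…,N-1}`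
and Alice sends `m` `p`-nary digits to Bob, who then outputs a guess for `x_y`. They share a
random variable in the finite set `Ω` and finitely many boxes, indexed by `ι`. Alice uses her
ends of the boxes and computes the message from all she knows; Bob uses his ends after
receiving the message. -/
structure Protocol (p N m : ℕ) (Ω ι : Type) [Fintype Ω] [Fintype ι] [DecidableEq ι] where
  weight : Ω → ℝ
  weight_nonneg : ∀ w, 0 ≤ weight w
  sum_weight : ∑ w, weight w = 1
  alice : Ω → (Fin N → ZMod p) → Strategy p ι
  alice_valid : ∀ w x, (alice w x).Valid Finset.univ
  message : Ω → (Fin N → ZMod p) → (ι → ZMod p) → (Fin m → ZMod p)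
  bob : Ω → Fin N → (Fin m → ZMod p) → Strategy p ι
  bob_valid : ∀ w y q, (bob w y q).Valid Finset.univ
  guess : Ω → Fin N → (Fin m → ZMod p) → (ι → ZMod p) → ZMod p

section
variable {p N m : ℕ} [NeZero p] {Ω ι : Type} [Fintype Ω] [Fintype ι] [DecidableEq ι]

/-- The probability that Bob outputs `g` on inputs `x`, `y`, when the shared boxes are
independent copies of `P`. Here `a`, `b` are the outputs of the boxes on the two sides. -/
def Protocol.outputProb (S : Protocol p N m Ω ι) (P : Box p)
    (x : Fin N → ZMod p) (y : Fin N) (g : ZMod p) : ℝ :=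
  ∑ w : Ω, S.weight w * ∑ a : ι → ZMod p, ∑ b : ι → ZMod p,
    if S.guess w y (S.message w x a) b = g then
      ∏ i : ι, P.prob (a i) (b i) ((S.alice w x).inputs a i)
        ((S.bob w y (S.message w x a)).inputs b i)
    else 0

/-- The joint law of `x_i` and Bob's output given `y = i`, for `x` uniform on `(ZMod p)^N`. -/
def Protocol.jointProb (S : Protocol p N m Ω ι) (P : Box p) (i : Fin N)
    (u g : ZMod p) : ℝ :=
  ∑ x : Fin N → ZMod p, if x i = u then ((p : ℝ) ^ N)⁻¹ * S.outputProb P x i g else 0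

end

/-- Shannon mutual information `H(U) + H(V) - H(U,V)` (in nats) of a joint law. -/
def mutualInfo {A B : Type} [Fintype A] [Fintype B] (J : A → B → ℝ) : ℝ :=
  ∑ u, Real.negMulLog (∑ v, J u v) + ∑ v, Real.negMulLog (∑ u, J u v)
    - ∑ u, ∑ v, Real.negMulLog (J u v)

/-- Information causality for the box `P`: whatever Alice and Bob do with shared randomness,
finitely many copies of `P` and a message of `m` `p`-nary digits,
`∑_i I(x_i : b | y = i) ≤ m log p`. -/
def InformationCausality {p : ℕ} [NeZero p] (P : Box p) : Prop :=
  ∀ (N m : ℕ) (Ω ι : Type) [Fintype Ω] [Fintype ι] [DecidableEq ι] (S : Protocol p N m Ω ι),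
    ∑ i : Fin N, mutualInfo (S.jointProb P i) ≤ m * Real.log p

/-! ### The function `h_p` and its inverse -/

/-- `h_p(x) = h(x) + (1 - x) log (p - 1)`, with `h` the binary entropy. -/
def hp (p : ℕ) (x : ℝ) : ℝ := Real.binEntropy x + (1 - x) * Real.log ((p : ℝ) - 1)

/-- `h_p` is a decreasing bijection from `[1/p, 1]` onto `[0, log p]`. -/
theorem hp_bijOn {p : ℕ} (h2 : 2 ≤ p) :
    StrictAntiOn (hp p) (Set.Icc (1 / (p : ℝ)) 1) ∧
      Set.BijOn (hp p) (Set.Icc (1 / (p : ℝ)) 1) (Set.Icc 0 (Real.log p)) := by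
  have hp2 : (2 : ℝ) ≤ p := by exact_mod_cast h2
  have hp0 : (0 : ℝ) < p := by linarith
  have hle : 1 / (p : ℝ) ≤ 1 := by rw [div_le_one hp0]; linarith
  have heq : ∀ x, hp p x = Real.qaryEntropy p (1 - x) := by
    intro x
    simp only [hp, Real.qaryEntropy, Real.binEntropy_one_sub]
    push_cast
    ring
  have hanti : StrictAntiOn (hp p) (Set.Icc (1 / (p : ℝ)) 1) := by
    intro x hx y hy hxy
    rw [heq, heq]
    apply Real.qaryEntropy_strictMonoOn h2
    · exact ⟨by linarith [hy.2], by linarith [hy.1]⟩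
    · exact ⟨by linarith [hx.2], by linarith [hx.1]⟩
    · linarith
  have h1 : hp p 1 = 0 := by simp [hp]
  have h0 : hp p (1 / (p : ℝ)) = Real.log p := by
    have hp1 : (0 : ℝ) < (p : ℝ) - 1 := by linarith
    have e : 1 - (p : ℝ)⁻¹ = ((p : ℝ) - 1) / p := by field_simp
    simp only [hp, Real.binEntropy, one_div, inv_inv]
    rw [e, inv_div, Real.log_div hp0.ne' hp1.ne']
    field_simp
    ring
  have hcont : Continuous (hp p) := by
    unfold hp
    fun_prop
  refine ⟨hanti, ?_, hanti.injOn, ?_⟩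
  · intro x hx
    rw [← h1, ← h0]
    exact ⟨hanti.antitoneOn hx ⟨hle, le_rfl⟩ hx.2, hanti.antitoneOn ⟨le_rfl, hle⟩ hx hx.1⟩
  · have h := intermediate_value_Icc' hle hcont.continuousOn
    rw [h1, h0] at h
    exact h

/-- The inverse `[0, log p] → [1/p, 1]` of the decreasing branch of `h_p`. -/
def hpInv (p : ℕ) (t : ℝ) : ℝ := Function.invFunOn (hp p) (Set.Icc (1 / (p : ℝ)) 1) t

/-! ### The bounded quantity -/

/-- `ω_p = exp(2πi/p)`. -/
def omega (p : ℕ) : ℂ := Complex.exp (2 * Real.pi * Complex.I / p)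

/-- `(1/p) ∑_k ω^{ck} (∑_j ν_j ω^{jk})^{L/2} (∑_j ν_j ω^{-jk})^{L/2}`, for even `L`. -/
def fourierSum {p : ℕ} [NeZero p] (v : ZMod p → ℝ) (c : ZMod p) (L : ℕ) : ℂ :=
  (1 / (p : ℂ)) * ∑ k ∈ Finset.range p, omega p ^ (c.val * k)
    * (∑ j : ZMod p, (v j : ℂ) * omega p ^ (j.val * k)) ^ (L / 2)
    * (∑ j : ZMod p, (v j : ℂ) * (omega p ^ (j.val * k))⁻¹) ^ (L / 2)

end

end FunctionalBox

open FunctionalBox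

/-! Boxes that compute `f` up to noise give a random access code with a one-digit message, and
information causality limits how well such a code can work. Here the noise of a box is `f x y - (a -
b)`; it equals `j` with probability at least `ν_j`, whatever the inputs.

Differences lower the degree of `f`. If `x^i y^j` attains `Δ(f)`, differences of order `i - 1` in
`x` and `j - 1` in `y` leave `γxy + g(x) + h(y)` with `γ ≠ 0` (`exists_isShiftSum_mul`). Their total
order `Δ(f) - 2` is positive, so this is a signed sum of `2^(Δ(f)-2)` translates of `f`, half of
each sign. One box per translate gives the parties noisy additive shares of it. Alice interpolates
her `N ≤ p` digits by a polynomial of degree below `N`. Each of its `N - 1` nonconstant terms is a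
coefficient of hers times a power of Bob's input, so one digit can carry the constant term together
with all her shares (`nonempty_scheme_of_le`). For `N = p^n` the code is nested (`Scheme.prod`):
only one inner block matters for a given digit, so block lengths multiply while noise counts add.

Bob's error is a signed sum of `L` noises. If he shifts his guess by `c`, he is right with at least
the weight that the product of the `ν` gives to the event `c + ∑ ± j = 0`, even though Alice acts
adaptively (`Strategy.le_sum_runs`). By orthogonality of characters this weight is the Fourier sum
(`fourierSum_eq_sum_noiseWeight`). Fano's inequality (`log_sub_hp_le_mutualInfo`) turns success
probability `q` into information at least `log p - h_p(q)` per digit. The total is at most `log p`,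
which bounds `q`. -/

namespace FunctionalBox

/-! ### Strategies -/

/-- Boxes are queried in order of rank, and `acc` records the answers received so far. A box of
least rank in `s` depends only on boxes outside `s`, where the true outputs agree with `acc`. -/
theorem Strategy.exists_inputs_eq_on {p : ℕ} {ι : Type} [DecidableEq ι] (rank : ι → ℕ) (X : (ι → ZMod p) → ι → ZMod p)
    (hX : ∀ i a a', (∀ k, rank k < rank i → a k = a' k) → X a i = X a' i) (s : Finset ι)
    (acc : ι → ZMod p) :
    ∃ T : Strategy p ι, T.Valid s ∧
      ∀ a, (∀ k, k ∉ s → a k = acc k) → ∀ i ∈ s, T.inputs a i = X a i := by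
  induction s using Finset.strongInduction generalizing acc with
  | H s ih =>
    rcases s.eq_empty_or_nonempty with rfl | hs
    · exact ⟨.halt, trivial, by simp⟩
    · obtain ⟨i, hi, hmin⟩ := s.exists_min_image rank hs
      choose next hv hn using fun v =>
        ih (s.erase i) (Finset.erase_ssubset hi) (Function.update acc i v)
      refine ⟨.use i (X acc i) next, ⟨hi, hv⟩, fun a ha k hk => ?_⟩
      rcases eq_or_ne k i with rfl | hki
      · simp only [Strategy.inputs, Function.update_self]
        refine hX _ _ _ fun l hl => (ha l fun hls => ?_).symm
        exact absurd (hmin l hls) (by omega)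
      · simp only [Strategy.inputs, Function.update_of_ne hki]
        refine hn (a i) a (fun l hl => ?_) k (Finset.mem_erase.2 ⟨hki, hk⟩)
        rcases eq_or_ne l i with rfl | hli
        · simp
        · rw [Function.update_of_ne hli]
          exact ha l fun hls => hl (Finset.mem_erase.2 ⟨hli, hls⟩)

/-- Inputs that depend only on the outputs of boxes of smaller rank come from a strategy. -/
theorem Strategy.exists_inputs_eq {p : ℕ} {ι : Type} [Fintype ι] [DecidableEq ι]
    (rank : ι → ℕ) (X : (ι → ZMod p) → ι → ZMod p)
    (hX : ∀ i a a', (∀ k, rank k < rank i → a k = a' k) → X a i = X a' i) :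
    ∃ T : Strategy p ι, T.Valid Finset.univ ∧ ∀ a, T.inputs a = X a := by
  obtain ⟨T, hT, h⟩ := Strategy.exists_inputs_eq_on rank X hX Finset.univ 0
  exact ⟨T, hT, fun a => funext fun i => h a (by simp) i (by simp)⟩

section Strategies
variable {p : ℕ} [NeZero p] {ι : Type} [Fintype ι] [DecidableEq ι]

/-- If the outputs of box `i` have total weight between `m i` and `M i` whatever its input, then
the weights of all runs of an adaptive strategy add up to something between the products. -/
theorem Strategy.sum_prod_mem_Icc (T : Strategy p ι) (G : ι → ZMod p → ZMod p → ℝ)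
    (m M : ι → ℝ) (hG : ∀ i x a, 0 ≤ G i x a) (hm0 : ∀ i, 0 ≤ m i)
    (hm : ∀ i x, m i ≤ ∑ a, G i x a) (hM : ∀ i x, ∑ a, G i x a ≤ M i) :
    ∏ i, m i ≤ ∑ a : ι → ZMod p, ∏ i, G i (T.inputs a i) (a i) ∧
      ∑ a : ι → ZMod p, ∏ i, G i (T.inputs a i) (a i) ≤ ∏ i, M i := by
  induction T generalizing G m M with
  | halt =>
    have h : ∑ a : ι → ZMod p, ∏ i, G i (Strategy.halt.inputs a i) (a i) =
        ∏ i, ∑ v, G i 0 v := by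
      rw [Finset.prod_univ_sum, Fintype.piFinset_univ]
      rfl
    rw [h]
    exact ⟨Finset.prod_le_prod (fun i _ => hm0 i) fun i _ => hm i 0,
      Finset.prod_le_prod (fun i _ => Finset.sum_nonneg fun a _ => hG i 0 a) fun i _ => hM i 0⟩
  | use i x next ih =>
    -- Once box `i` has answered `v`, its weight becomes a point mass at `v` for every input, with
    -- both bounds reset to 1. The factor `G i x v` is pulled out, and the induction hypothesis
    -- applies to the branch `next v`.
    set G' : ZMod p → ι → ZMod p → ZMod p → ℝ :=
      fun v => Function.update G i (fun _ a => if a = v then 1 else 0) with hG'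
    have hsum : ∑ a : ι → ZMod p, ∏ k, G k ((Strategy.use i x next).inputs a k) (a k) =
        ∑ v, G i x v * ∑ a : ι → ZMod p, ∏ k, G' v k ((next v).inputs a k) (a k) := by
      simp only [Finset.mul_sum]
      rw [Finset.sum_comm]
      refine Finset.sum_congr rfl fun a _ => ?_
      rw [Fintype.sum_eq_single (a i)]
      · rw [← Finset.mul_prod_erase Finset.univ _ (Finset.mem_univ i),
          ← Finset.mul_prod_erase Finset.univ
            (fun k => G' (a i) k ((next (a i)).inputs a k) (a k)) (Finset.mem_univ i)]
        have h1 : G' (a i) i ((next (a i)).inputs a i) (a i) = 1 := by simp [hG']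
        rw [h1, one_mul]
        congr 1
        · simp [Strategy.inputs]
        · refine Finset.prod_congr rfl fun k hk => ?_
          have hk' := Finset.ne_of_mem_erase hk
          simp [Strategy.inputs, hG', hk']
      · intro v hv
        rw [Finset.prod_eq_zero (Finset.mem_univ i), mul_zero]
        simp [hG', Ne.symm hv]
    have key : ∀ v, ∏ k, Function.update m i 1 k ≤
          ∑ a : ι → ZMod p, ∏ k, G' v k ((next v).inputs a k) (a k) ∧
        ∑ a : ι → ZMod p, ∏ k, G' v k ((next v).inputs a k) (a k) ≤
          ∏ k, Function.update M i 1 k := by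
      intro v
      refine ih v (G' v) _ _ ?_ ?_ ?_ ?_
      · intro k y a
        rcases eq_or_ne k i with rfl | hk
        · simp only [hG', Function.update_self]; split_ifs <;> norm_num
        · simpa [hG', hk] using hG k y a
      · intro k
        rcases eq_or_ne k i with rfl | hk
        · simp
        · simpa [hk] using hm0 k
      · intro k y
        rcases eq_or_ne k i with rfl | hk
        · simp [hG']
        · simpa [hG', hk] using hm k y
      · intro k y
        rcases eq_or_ne k i with rfl | hk
        · simp [hG']
        · simpa [hG', hk] using hM k y
    have hp : ∀ m : ι → ℝ, ∏ k, m k = m i * ∏ k, Function.update m i 1 k := by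
      intro m
      rw [Finset.prod_update_of_mem (Finset.mem_univ i), one_mul, Finset.sdiff_singleton_eq_erase,
        Finset.mul_prod_erase _ _ (Finset.mem_univ i)]
    have hmu : 0 ≤ ∏ k, Function.update m i 1 k := by
      refine Finset.prod_nonneg fun k _ => ?_
      rcases eq_or_ne k i with rfl | hk
      · simp
      · simpa [hk] using hm0 k
    rw [hsum, hp m, hp M]
    constructor
    · calc _ ≤ (∑ v, G i x v) * ∏ k, Function.update m i 1 k :=
            mul_le_mul_of_nonneg_right (hm i x) hmu
        _ ≤ _ := by
          rw [Finset.sum_mul]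
          exact Finset.sum_le_sum fun v _ => mul_le_mul_of_nonneg_left (key v).1 (hG i x v)
    · calc _ ≤ (∑ v, G i x v) * ∏ k, Function.update M i 1 k := by
            rw [Finset.sum_mul]
            exact Finset.sum_le_sum fun v _ => mul_le_mul_of_nonneg_left (key v).2 (hG i x v)
        _ ≤ _ := mul_le_mul_of_nonneg_right (hM i x) (hmu.trans ((key 0).1.trans (key 0).2))

/-- When Bob's inputs are fixed, the probability of an event about the values `n i x a b`
attached to the boxes is at least its weight under lower bounds for the laws of these values. -/
theorem Strategy.le_sum_runs (P : Box p) (T : Strategy p ι) (Y : ι → ZMod p)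
    (n : ι → ZMod p → ZMod p → ZMod p → ZMod p) (μ : ι → ZMod p → ℝ) (hμ0 : ∀ i j, 0 ≤ μ i j)
    (hμ : ∀ i x j, μ i j ≤ ∑ a, ∑ b, if n i x a b = j then P.prob a b x (Y i) else 0)
    (Φ : (ι → ZMod p) → Prop) [DecidablePred Φ] :
    (∑ j : ι → ZMod p, if Φ j then ∏ i, μ i (j i) else 0) ≤
      ∑ a : ι → ZMod p, ∑ b : ι → ZMod p,
        if Φ (fun i => n i (T.inputs a i) (a i) (b i)) then
          ∏ i, P.prob (a i) (b i) (T.inputs a i) (Y i) else 0 := by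
  -- The event is split according to the joint value `j` of all the `n i`, so that each piece is a
  -- product over the boxes.
  have h : ∀ a b : ι → ZMod p, (if Φ (fun i => n i (T.inputs a i) (a i) (b i)) then
          ∏ i, P.prob (a i) (b i) (T.inputs a i) (Y i) else 0) =
      ∑ j : ι → ZMod p, if Φ j then ∏ i, (if n i (T.inputs a i) (a i) (b i) = j i then
        P.prob (a i) (b i) (T.inputs a i) (Y i) else 0) else 0 := by
    intro a b
    rw [Fintype.sum_eq_single (fun i => n i (T.inputs a i) (a i) (b i))]
    · simp
    · intro j hj
      obtain ⟨i, hi⟩ := Function.ne_iff.1 hj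
      rw [Finset.prod_eq_zero (Finset.mem_univ i) (if_neg (Ne.symm hi)), ite_self]
  simp only [h]
  refine le_of_le_of_eq ?_ (Finset.sum_congr rfl fun a _ => Finset.sum_comm)
  rw [Finset.sum_comm]
  refine Finset.sum_le_sum fun j _ => ?_
  split_ifs with hj
  -- Bob's inputs are fixed, so for given `a` the sum over `b` factorises. What remains is a run of
  -- Alice's strategy alone.
  · have h3 : ∀ a : ι → ZMod p, ∑ b : ι → ZMod p, ∏ i,
        (if n i (T.inputs a i) (a i) (b i) = j i then
          P.prob (a i) (b i) (T.inputs a i) (Y i) else 0) =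
        ∏ i, ∑ b, if n i (T.inputs a i) (a i) b = j i then
          P.prob (a i) b (T.inputs a i) (Y i) else 0 := by
      intro a
      rw [Finset.prod_univ_sum, Fintype.piFinset_univ]
    simp only [h3]
    refine (T.sum_prod_mem_Icc
      (fun i x a => ∑ b, if n i x a b = j i then P.prob a b x (Y i) else 0)
      (fun i => μ i (j i)) (fun i => 1) ?_ (fun i => hμ0 i _) (fun i x => hμ i x _) ?_).1
    · intro i x a
      refine Finset.sum_nonneg fun b _ => ?_
      split_ifs
      · exact P.prob_nonneg _ _ _ _
      · exact le_rfl
    · intro i x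
      rw [← P.sum_prob x (Y i)]
      refine Finset.sum_le_sum fun a _ => Finset.sum_le_sum fun b _ => ?_
      split_ifs
      · exact le_rfl
      · exact P.prob_nonneg _ _ _ _
  · simp

theorem Strategy.sum_runs_eq_one (P : Box p) (T : Strategy p ι) (Y : ι → ZMod p) :
    ∑ a : ι → ZMod p, ∑ b : ι → ZMod p, ∏ i, P.prob (a i) (b i) (T.inputs a i) (Y i) = 1 := by
  have h3 : ∀ a : ι → ZMod p, ∑ b : ι → ZMod p, ∏ i, P.prob (a i) (b i) (T.inputs a i) (Y i) =
      ∏ i, ∑ b, P.prob (a i) b (T.inputs a i) (Y i) := by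
    intro a
    rw [Finset.prod_univ_sum, Fintype.piFinset_univ]
  simp only [h3]
  have h := T.sum_prod_mem_Icc (fun i x a => ∑ b, P.prob a b x (Y i)) (fun _ => 1) (fun _ => 1)
    (fun i x a => Finset.sum_nonneg fun b _ => P.prob_nonneg _ _ _ _) (fun _ => zero_le_one)
    (fun i x => (P.sum_prob x (Y i)).ge) (fun i x => (P.sum_prob x (Y i)).le)
  simp only [Finset.prod_const_one] at h
  exact le_antisymm h.2 h.1

end Strategies

/-! ### Fano's inequality -/

/-- This is `log t ≤ t - 1` at `t = c / x`, the termwise form of Gibbs' inequality. The last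
hypothesis is needed because `Real.log 0 = 0`. -/
theorem mul_log_add_negMulLog_le {x c : ℝ} (hx : 0 ≤ x) (hc : 0 ≤ c) (h : 0 < x → 0 < c) :
    x * Real.log c + Real.negMulLog x ≤ c - x := by
  rcases hx.eq_or_lt with rfl | hx
  · simpa using hc
  · have h1 := Real.log_le_sub_one_of_pos (div_pos (h hx) hx)
    rw [Real.log_div (h hx).ne' hx.ne'] at h1
    have h2 := mul_le_mul_of_nonneg_left h1 hx.le
    have h3 : x * (c / x - 1) = c - x := by field_simp
    rw [h3] at h2
    simp only [Real.negMulLog]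
    linarith

/-- Fano's inequality for a uniform variable on `ZMod p` and a guess of it. -/
theorem log_sub_hp_le_mutualInfo {p : ℕ} [NeZero p] (h2 : 2 ≤ p) (J : ZMod p → ZMod p → ℝ)
    (hJ : ∀ u v, 0 ≤ J u v) (hu : ∀ u, ∑ v, J u v = (p : ℝ)⁻¹) :
    Real.log p - hp p (∑ u, J u u) ≤ mutualInfo J := by
  have hp2 : (2 : ℝ) ≤ p := by exact_mod_cast h2
  set s := ∑ u, J u u with hs
  set V : ZMod p → ℝ := fun v => ∑ u, J u v with hV
  have htot : ∑ u, ∑ v, J u v = 1 := by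
    simp only [hu, Finset.sum_const, Finset.card_univ, ZMod.card, nsmul_eq_mul]
    exact mul_inv_cancel₀ (by positivity)
  have hdiag : ∀ u, J u u ≤ ∑ v, J u v :=
    fun u => Finset.single_le_sum (fun v _ => hJ u v) (Finset.mem_univ u)
  have hs0 : 0 ≤ s := Finset.sum_nonneg fun u _ => hJ u u
  have hs1 : s ≤ 1 := htot ▸ Finset.sum_le_sum fun u _ => hdiag u
  have hoff : 1 - s = ∑ u, ∑ v, if u = v then 0 else J u v := by
    rw [← htot, hs, ← Finset.sum_sub_distrib]
    refine Finset.sum_congr rfl fun u _ => ?_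
    have : J u u = ∑ v, if u = v then J u v else 0 := by simp
    rw [this, ← Finset.sum_sub_distrib]
    refine Finset.sum_congr rfl fun v _ => ?_
    split_ifs <;> simp
  have hoff0 : ∀ u v, 0 ≤ if u = v then 0 else J u v := by
    intro u v; split_ifs
    · exact le_rfl
    · exact hJ u v
  -- The conditional law of `u` given the guess `v` if all errors were equally likely. Gibbs'
  -- inequality compares `J` with `V v * w u v`, and the cross term of `w` is exactly `-hp p s`.
  set w : ZMod p → ZMod p → ℝ := fun u v => if u = v then s else (1 - s) / (p - 1) with hw
  have hw0 : ∀ u v, 0 ≤ w u v := by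
    intro u v; simp only [hw]; split_ifs
    · exact hs0
    · exact div_nonneg (by linarith) (by linarith)
  have hwpos : ∀ u v, 0 < J u v → 0 < w u v := by
    intro u v h
    simp only [hw]; split_ifs with huv
    · subst huv
      exact h.trans_le (Finset.single_le_sum (f := fun u => J u u) (fun u _ => hJ u u)
        (Finset.mem_univ u))
    · refine div_pos ?_ (by linarith)
      rw [hoff]
      calc 0 < J u v := h
        _ = if u = v then 0 else J u v := by rw [if_neg huv]
        _ ≤ ∑ v, if u = v then 0 else J u v :=
          Finset.single_le_sum (fun v _ => hoff0 u v) (Finset.mem_univ v)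
        _ ≤ _ := Finset.single_le_sum (f := fun u => ∑ v, if u = v then 0 else J u v)
          (fun u _ => Finset.sum_nonneg fun v _ => hoff0 u v) (Finset.mem_univ u)
  have hVpos : ∀ u v, 0 < J u v → 0 < V v := fun u v h =>
    h.trans_le (Finset.single_le_sum (f := fun u => J u v) (fun u _ => hJ u v)
      (Finset.mem_univ u))
  have hV0 : ∀ v, 0 ≤ V v := fun v => Finset.sum_nonneg fun u _ => hJ u v
  have hwsum : ∀ v, ∑ u, w u v = 1 := by
    intro v
    have : ∀ u, w u v = (1 - s) / (p - 1) + if u = v then s - (1 - s) / (p - 1) else 0 := by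
      intro u; simp only [hw]; split_ifs <;> ring
    simp only [this, Finset.sum_add_distrib, Finset.sum_const, Finset.card_univ, ZMod.card,
      nsmul_eq_mul, Finset.sum_ite_eq', Finset.mem_univ, if_true]
    have : (p : ℝ) - 1 ≠ 0 := by linarith
    field_simp
    ring
  have hVsum : ∑ v, V v = 1 := by rw [← htot, hV, Finset.sum_comm]
  have gibbs : ∑ u, ∑ v, (J u v * Real.log (V v) + J u v * Real.log (w u v)
      + Real.negMulLog (J u v)) ≤ 0 := by
    calc _ ≤ ∑ u, ∑ v, (V v * w u v - J u v) := by
          refine Finset.sum_le_sum fun u _ => Finset.sum_le_sum fun v _ => ?_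
          refine le_trans (le_of_eq ?_) (mul_log_add_negMulLog_le (hJ u v)
            (mul_nonneg (hV0 v) (hw0 u v)) fun h => mul_pos (hVpos u v h) (hwpos u v h))
          rcases (hJ u v).eq_or_lt with h | h
          · simp [← h]
          · rw [Real.log_mul (hVpos u v h).ne' (hwpos u v h).ne', mul_add]
      _ = 0 := by
          simp only [Finset.sum_sub_distrib]
          rw [htot, Finset.sum_comm]
          simp only [← Finset.mul_sum, hwsum, mul_one, hVsum, sub_self]
  simp only [Finset.sum_add_distrib] at gibbs
  have e1 : ∑ u, ∑ v, J u v * Real.log (V v) = -∑ v, Real.negMulLog (V v) := by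
    rw [Finset.sum_comm, ← Finset.sum_neg_distrib]
    refine Finset.sum_congr rfl fun v _ => ?_
    rw [← Finset.sum_mul]
    simp [Real.negMulLog, hV]
  have e2 : ∑ u, ∑ v, J u v * Real.log (w u v) = -hp p s := by
    have : ∀ u v, J u v * Real.log (w u v) = (if u = v then J u v else 0) * Real.log s
        + (if u = v then 0 else J u v) * Real.log ((1 - s) / (p - 1)) := by
      intro u v; simp only [hw]; split_ifs <;> simp
    simp only [this, Finset.sum_add_distrib, ← Finset.sum_mul, ← hoff]
    simp only [Finset.sum_ite_eq, Finset.mem_univ, if_true, ← hs, hp]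
    rw [Real.binEntropy_eq_negMulLog_add_negMulLog_one_sub]
    simp only [Real.negMulLog]
    rcases hs1.eq_or_lt with h | h
    · simp [h]
    · rw [Real.log_div (by linarith) (by linarith)]
      ring
  have e3 : ∑ u : ZMod p, Real.negMulLog (∑ v, J u v) = Real.log p := by
    simp only [hu, Finset.sum_const, Finset.card_univ, ZMod.card, nsmul_eq_mul, Real.negMulLog,
      Real.log_inv]
    have : (p : ℝ) ≠ 0 := by positivity
    field_simp
  simp only [mutualInfo, e3]
  rw [e1, e2] at gibbs
  linarith

/-! ### Finite differences of bivariate functions -/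

section Differences
variable {p : ℕ}

/-- `F` is a difference of two sums of `l` translates of `f` each. -/
def IsShiftSum (f : ZMod p → ZMod p → ZMod p) (l : ℕ) (F : ZMod p → ZMod p → ZMod p) : Prop :=
  ∃ s t s' t' : Fin l → ZMod p, ∀ x y,
    F x y = ∑ k, f (x + s k) (y + t k) - ∑ k, f (x + s' k) (y + t' k)

theorem isShiftSum_sub (f : ZMod p → ZMod p → ZMod p) (u v : ZMod p) :
    IsShiftSum f 1 (fun x y => f (x + u) (y + v) - f x y) :=
  ⟨fun _ => u, fun _ => v, fun _ => 0, fun _ => 0, by simp⟩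

/-- In the subtracted copy of `F` the positive and negative translates change roles, so the two
signs stay balanced and each count doubles. -/
theorem IsShiftSum.sub_shift {f F : ZMod p → ZMod p → ZMod p} {l : ℕ} (h : IsShiftSum f l F)
    (u v : ZMod p) : IsShiftSum f (l + l) (fun x y => F (x + u) (y + v) - F x y) := by
  obtain ⟨s, t, s', t', h⟩ := h
  refine ⟨Fin.append (fun k => u + s k) s', Fin.append (fun k => v + t k) t',
    Fin.append (fun k => u + s' k) s, Fin.append (fun k => v + t' k) t, fun x y => ?_⟩
  simp only [h, Fin.sum_univ_add, Fin.append_left, Fin.append_right, add_assoc]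
  abel

/-- The difference of order `m` in the first and `n` in the second variable. -/
def mixedDiff (m n : ℕ) (f : ZMod p → ZMod p → ZMod p) (x y : ZMod p) : ZMod p :=
  (fwdDiff 1)^[m] (fun x' => (fwdDiff 1)^[n] (f x') y) x

theorem mixedDiff_succ_left (m n : ℕ) (f : ZMod p → ZMod p → ZMod p) (x y : ZMod p) :
    mixedDiff (m + 1) n f x y = mixedDiff m n f (x + 1) y - mixedDiff m n f x y := by
  simp only [mixedDiff, Function.iterate_succ_apply', fwdDiff]

theorem mixedDiff_succ_right (m n : ℕ) (f : ZMod p → ZMod p → ZMod p) (x y : ZMod p) :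
    mixedDiff m (n + 1) f x y = mixedDiff m n f x (y + 1) - mixedDiff m n f x y := by
  induction m generalizing x with
  | zero => simp only [mixedDiff, Function.iterate_succ_apply', Function.iterate_zero, id, fwdDiff]
  | succ m ih => rw [mixedDiff_succ_left, mixedDiff_succ_left, mixedDiff_succ_left, ih, ih]; ring

/-- The first difference already produces one translate of each sign; each of the other `m + n`
doubles both counts. -/
theorem isShiftSum_mixedDiff_succ_left (f : ZMod p → ZMod p → ZMod p) (m n : ℕ) :
    IsShiftSum f (2 ^ (m + n)) (mixedDiff (m + 1) n f) := by
  induction n with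
  | zero =>
    induction m with
    | zero =>
      convert isShiftSum_sub f 1 0 using 1
      · simp
      funext x y
      simp [mixedDiff, fwdDiff]
    | succ m ih =>
      convert ih.sub_shift 1 0 using 1
      · ring
      · funext x y
        rw [mixedDiff_succ_left, add_zero]
  | succ n ih =>
    convert ih.sub_shift 0 1 using 1
    · ring
    · funext x y
      rw [mixedDiff_succ_right, add_zero]

theorem isShiftSum_mixedDiff_zero_left (f : ZMod p → ZMod p → ZMod p) (n : ℕ) :
    IsShiftSum f (2 ^ n) (mixedDiff 0 (n + 1) f) := by
  induction n with
  | zero =>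
    convert isShiftSum_sub f 0 1 using 1
    · simp
    funext x y
    simp [mixedDiff, fwdDiff]
  | succ n ih =>
    convert ih.sub_shift 0 1 using 1
    · ring
    · funext x y
      rw [mixedDiff_succ_right, add_zero]

theorem isShiftSum_mixedDiff (f : ZMod p → ZMod p → ZMod p) {m n l : ℕ} (h : m + n = l + 1) :
    IsShiftSum f (2 ^ l) (mixedDiff m n f) := by
  cases m with
  | zero =>
    obtain rfl : n = l + 1 := by omega
    exact isShiftSum_mixedDiff_zero_left f l
  | succ m =>
    obtain rfl : l = m + n := by omega
    exact isShiftSum_mixedDiff_succ_left f m n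

theorem mixedDiff_sum_monomials {α : Type} (s : Finset α) (c : α → ZMod p) (d e : α → ℕ)
    (m n : ℕ) (x y : ZMod p) :
    mixedDiff m n (fun x y => ∑ k ∈ s, c k * x ^ d k * y ^ e k) x y =
      ∑ k ∈ s, c k * (fwdDiff 1)^[m] (fun x : ZMod p => x ^ d k) x *
        (fwdDiff 1)^[n] (fun y : ZMod p => y ^ e k) y := by
  have h1 : ∀ x', (fwdDiff 1)^[n] (fun y : ZMod p => ∑ k ∈ s, c k * x' ^ d k * y ^ e k) y =
      ∑ k ∈ s, c k * x' ^ d k * (fwdDiff 1)^[n] (fun y : ZMod p => y ^ e k) y := by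
    intro x'
    have : (fun y : ZMod p => ∑ k ∈ s, c k * x' ^ d k * y ^ e k) =
        ∑ k ∈ s, (c k * x' ^ d k) • fun y : ZMod p => y ^ e k := by
      funext y; simp [Finset.sum_apply]
    rw [this, fwdDiff_iter_finsetSum, Finset.sum_apply]
    exact Finset.sum_congr rfl fun k _ => by rw [fwdDiff_iter_const_smul]; rfl
  simp only [mixedDiff, h1]
  have : (fun x' : ZMod p => ∑ k ∈ s, c k * x' ^ d k *
      (fwdDiff 1)^[n] (fun y : ZMod p => y ^ e k) y) =
      ∑ k ∈ s, (c k * (fwdDiff 1)^[n] (fun y : ZMod p => y ^ e k) y) •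
        fun x : ZMod p => x ^ d k := by
    funext x; simp only [Finset.sum_apply, Pi.smul_apply, smul_eq_mul]
    exact Finset.sum_congr rfl fun k _ => by ring
  rw [this, fwdDiff_iter_finsetSum, Finset.sum_apply]
  exact Finset.sum_congr rfl fun k _ => by
    rw [fwdDiff_iter_const_smul, Pi.smul_apply, smul_eq_mul]; ring

/-- Every element of `ZMod p` is reached from 0 by adding 1. -/
theorem eq_linear_of_forall_add_one [NeZero p] {G : ZMod p → ZMod p} {γ : ZMod p}
    (h : ∀ x, G (x + 1) = G x + γ) (x : ZMod p) : G x = G 0 + γ * x := by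
  have key : ∀ n : ℕ, G n = G 0 + γ * n := by
    intro n
    induction n with
    | zero => simp
    | succ n ih => rw [Nat.cast_succ, h, ih]; ring
  simpa using key x.val

/-- A function whose mixed difference of order `(1, 1)` is constant. -/
theorem eq_mul_add_of_mixedDiff [NeZero p] {F : ZMod p → ZMod p → ZMod p} {γ : ZMod p}
    (h : ∀ x y, F (x + 1) (y + 1) - F x (y + 1) - (F (x + 1) y - F x y) = γ) (x y : ZMod p) :
    F x y = γ * x * y + F x 0 + (F 0 y - F 0 0) := by
  have h1 : ∀ x y, F x (y + 1) - F x y = F 0 (y + 1) - F 0 y + γ * x := fun x y =>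
    eq_linear_of_forall_add_one (G := fun x => F x (y + 1) - F x y)
      (fun x => by linear_combination h x y) x
  have h2 := eq_linear_of_forall_add_one (G := fun y => F x y - F 0 y) (γ := γ * x)
    (fun y => by linear_combination h1 x y) y
  linear_combination h2

/-- Differences of `f` of total order `Δ(f) - 2` yield the product of the two inputs. -/
theorem exists_isShiftSum_mul [Fact p.Prime] (f : ZMod p → ZMod p → ZMod p)
    (hΔ : 2 < Delta f) :
    ∃ (γ : ZMod p) (g h : ZMod p → ZMod p), γ ≠ 0 ∧
      IsShiftSum f (2 ^ (Delta f - 3)) (fun x y => γ * x * y + g x + h y) := by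
  set S := (Finset.univ : Finset (Fin p × Fin p)).filter
      (fun ij => 1 ≤ (ij.1 : ℕ) ∧ 1 ≤ (ij.2 : ℕ)) with hS
  set φ : Fin p × Fin p → ℕ :=
    fun ij => if coeffs f ij.1 ij.2 ≠ 0 then (ij.1 : ℕ) + (ij.2 : ℕ) else 0 with hφ
  have hD : Delta f = S.sup φ := rfl
  have hne : S.Nonempty := by
    rw [Finset.nonempty_iff_ne_empty]
    intro h
    rw [hD, h, Finset.sup_empty] at hΔ
    exact absurd hΔ (by simp)
  obtain ⟨⟨i, j⟩, hij, hmax⟩ := Finset.exists_mem_eq_sup S hne φ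
  rw [← hD] at hmax
  have hc : coeffs f i j ≠ 0 := by
    intro h
    simp only [hφ, h, ne_eq, not_true_eq_false, if_false] at hmax
    omega
  have hsum : Delta f = i + j := by simpa [hφ, hc] using hmax
  obtain ⟨hi, hj⟩ : 1 ≤ (i : ℕ) ∧ 1 ≤ (j : ℕ) := by simpa [hS] using hij
  obtain ⟨i', hi'⟩ := Nat.exists_eq_add_of_le' hi
  obtain ⟨j', hj'⟩ := Nat.exists_eq_add_of_le' hj
  -- Exponents are below `p`, so the factorials produced by differencing are nonzero modulo `p`.
  have hfac : ∀ k : Fin p, ((Nat.factorial k : ℕ) : ZMod p) ≠ 0 := by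
    intro k hk
    rw [ZMod.natCast_eq_zero_iff, (Fact.out : p.Prime).dvd_factorial] at hk
    exact absurd k.2 (by omega)
  have hf : f = fun x y => ∑ k : Fin p × Fin p,
      coeffs f k.1 k.2 * x ^ (k.1 : ℕ) * y ^ (k.2 : ℕ) := by
    funext x y
    rw [coeffs_spec f x y, Fintype.sum_prod_type]
  have hij : ∀ x y, mixedDiff i j f x y =
      coeffs f i j * (Nat.factorial i : ℕ) * (Nat.factorial j : ℕ) := by
    intro x y
    conv_lhs => rw [hf]
    rw [mixedDiff_sum_monomials, Fintype.sum_eq_single (i, j)]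
    · rw [fwdDiff_iter_eq_factorial, fwdDiff_iter_eq_factorial]
      rfl
    -- Differencing kills monomials of degree below `i` in `x` or below `j` in `y`. Any other
    -- monomial with nonzero coefficient has `a ≥ i`, `b ≥ j` and `a + b ≤ i + j`, hence is the
    -- chosen one.
    · rintro ⟨a, b⟩ hab
      by_cases ha : a < i
      · rw [fwdDiff_iter_pow_eq_zero_of_lt (by exact_mod_cast ha)]; simp
      by_cases hb : b < j
      · rw [fwdDiff_iter_pow_eq_zero_of_lt (n := j) (by exact_mod_cast hb)]; simp
      have ha' : (i : ℕ) ≤ a := by exact_mod_cast not_lt.1 ha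
      have hb' : (j : ℕ) ≤ b := by exact_mod_cast not_lt.1 hb
      have hz : coeffs f a b = 0 := by
        by_contra hz
        have hle : φ (a, b) ≤ S.sup φ :=
          Finset.le_sup (by simp only [hS, Finset.mem_filter, Finset.mem_univ, true_and]; omega)
        rw [← hD, hsum] at hle
        simp only [hφ, ne_eq, hz, not_false_eq_true, if_true] at hle
        exact hab (Prod.ext (Fin.ext (by simp only; omega)) (Fin.ext (by simp only; omega)))
      simp [hz]
  -- With `i = i' + 1` and `j = j' + 1`, the order is `i' + j' = (Δ - 3) + 1`. One more difference
  -- in each variable gives the constant of `hij`, which becomes `γ`.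
  refine ⟨_, fun x => mixedDiff i' j' f x 0, fun y => mixedDiff i' j' f 0 y - mixedDiff i' j' f 0 0,
    mul_ne_zero (mul_ne_zero hc (hfac i)) (hfac j), ?_⟩
  convert isShiftSum_mixedDiff f (m := i') (n := j') (l := Delta f - 3) (by omega) using 1
  funext x y
  refine (eq_mul_add_of_mixedDiff (fun x y => ?_) x y).symm
  rw [← hij x y, hi', hj', mixedDiff_succ_right, mixedDiff_succ_left, mixedDiff_succ_left]

/-- Lagrange interpolation; the nodes `0, …, N - 1` are distinct modulo `p` because `N ≤ p`. -/
theorem exists_interpolation [Fact p.Prime] {N : ℕ} (hN : N ≤ p) (x : Fin N → ZMod p) :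
    ∃ c : ℕ → ZMod p, ∀ y : Fin N, x y = ∑ d ∈ Finset.range N, c d * ((y : ℕ) : ZMod p) ^ d := by
  have hinj : Set.InjOn (fun i : Fin N => ((i : ℕ) : ZMod p)) (Finset.univ : Finset (Fin N)) := by
    intro i _ j _ hij
    have h := (ZMod.natCast_eq_natCast_iff' _ _ _).1 hij
    rw [Nat.mod_eq_of_lt (by omega), Nat.mod_eq_of_lt (by omega)] at h
    exact Fin.ext h
  refine ⟨(Lagrange.interpolate Finset.univ (fun i : Fin N => ((i : ℕ) : ZMod p)) x).coeff,
    fun y => ?_⟩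
  rw [← Lagrange.eval_interpolate_at_node x hinj (Finset.mem_univ y)]
  refine Polynomial.eval_eq_sum_range' ?_ _
  have h := Lagrange.degree_interpolate_lt x hinj
  rw [Finset.card_univ, Fintype.card_fin] at h
  rcases eq_or_ne (Lagrange.interpolate Finset.univ (fun i : Fin N => ((i : ℕ) : ZMod p)) x) 0
    with h0 | h0
  · rw [h0, Polynomial.natDegree_zero]
    exact y.pos
  · exact (Polynomial.natDegree_lt_iff_degree_lt h0).2 h

end Differences

/-! ### Random access codes with boxes -/

section Schemes

/-- `A`, `B` or `1`, according to the sign. -/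
def signCase (A B : ℂ) : SignType → ℂ
  | 0 => 1
  | 1 => A
  | -1 => B

/-- A way of encoding a family `x : I → ZMod p` into a single digit with the help of boxes that
compute `a - b = f(x, y)` up to noise. The digit determines each `x y` up to the noise of `2 l`
boxes, half of which enter with sign `+` and half with sign `-`. -/
structure Scheme {p : ℕ} (f : ZMod p → ZMod p → ZMod p) (I : Type) (l : ℕ) where
  ι : Type
  fintype : Fintype ι
  decEq : DecidableEq ι
  rank : ι → ℕ
  input : (I → ZMod p) → (ι → ZMod p) → ι → ZMod p
  causal : ∀ x i a a', (∀ k, rank k < rank i → a k = a' k) → input x a i = input x a' i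
  message : (I → ZMod p) → (ι → ZMod p) → ZMod p
  bobInput : I → ι → ZMod p
  sign : I → ι → SignType
  offset : I → ZMod p
  prod_sign : ∀ y (A B : ℂ), ∏ i, signCase A B (sign y i) = A ^ l * B ^ l
  message_eq : ∀ x a y, message x a =
    x y + offset y + ∑ i, (sign y i : ZMod p) * (a i - f (input x a i) (bobInput y i))

attribute [instance] Scheme.fintype Scheme.decEq

variable {p : ℕ} {f : ZMod p → ZMod p → ZMod p}

def Scheme.reindex {I J : Type} {l : ℕ} (S : Scheme f I l) (e : I ≃ J) : Scheme f J l where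
  ι := S.ι
  fintype := S.fintype
  decEq := S.decEq
  rank := S.rank
  input x := S.input (x ∘ e)
  causal x := S.causal (x ∘ e)
  message x := S.message (x ∘ e)
  bobInput y := S.bobInput (e.symm y)
  sign y := S.sign (e.symm y)
  offset y := S.offset (e.symm y)
  prod_sign y := S.prod_sign (e.symm y)
  message_eq x a y := by
    rw [S.message_eq (x ∘ e) a (e.symm y)]
    simp

/-- The scheme for a single digit, which uses no boxes. -/
def Scheme.single (f : ZMod p → ZMod p → ZMod p) : Scheme f (Fin 1) 0 where
  ι := Empty
  fintype := inferInstance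
  decEq := inferInstance
  rank _ := 0
  input _ _ _ := 0
  causal _ _ _ _ _ := rfl
  message x _ := x 0
  bobInput _ _ := 0
  sign _ _ := 0
  offset _ := 0
  prod_sign _ A B := by simp
  message_eq x a y := by rw [Subsingleton.elim y 0]; simp

/-- Concatenation: each row is encoded with `S₂`, and the resulting digits with `S₁`. -/
def Scheme.prod {I J : Type} [Fintype I] [DecidableEq I] {l₁ l₂ : ℕ} (S₁ : Scheme f I l₁)
    (S₂ : Scheme f J l₂) : Scheme f (I × J) (l₁ + l₂) where
  ι := S₁.ι ⊕ I × S₂.ι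
  fintype := inferInstance
  decEq := inferInstance
  -- Inputs of the outer boxes depend on the inner messages, so outer ranks lie above all inner
  -- ones.
  rank := Sum.elim (fun i => Finset.univ.sup S₂.rank + 1 + S₁.rank i) (fun k => S₂.rank k.2)
  input x a := Sum.elim
    (S₁.input (fun u => S₂.message (fun v => x (u, v)) (fun k => a (Sum.inr (u, k))))
      (fun i => a (Sum.inl i)))
    (fun k => S₂.input (fun v => x (k.1, v)) (fun k' => a (Sum.inr (k.1, k'))) k.2)
  causal x i a a' h := by
    rcases i with i | ⟨u, k⟩
    · have h1 : ∀ u k, a (Sum.inr (u, k)) = a' (Sum.inr (u, k)) := by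
        intro u k
        apply h
        have : S₂.rank k ≤ Finset.univ.sup S₂.rank := Finset.le_sup (Finset.mem_univ k)
        simp only [Sum.elim_inl, Sum.elim_inr]
        omega
      simp only [Sum.elim_inl, h1]
      refine S₁.causal _ _ _ _ fun k hk => h _ ?_
      simp only [Sum.elim_inl]
      omega
    · exact S₂.causal _ _ _ _ fun k hk => h _ hk
  message x a := S₁.message
    (fun u => S₂.message (fun v => x (u, v)) (fun k => a (Sum.inr (u, k))))
    (fun i => a (Sum.inl i))
  bobInput y := Sum.elim (S₁.bobInput y.1) (fun k => S₂.bobInput y.2 k.2)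
  -- Only the row containing `y` is decoded; the boxes of other rows get sign 0 and contribute no
  -- noise.
  sign y := Sum.elim (S₁.sign y.1) (fun k => if k.1 = y.1 then S₂.sign y.2 k.2 else 0)
  offset y := S₁.offset y.1 + S₂.offset y.2
  prod_sign y A B := by
    rw [Fintype.prod_sum_type, Fintype.prod_prod_type]
    simp only [Sum.elim_inl, Sum.elim_inr]
    rw [Fintype.prod_eq_single y.1]
    · simp only [if_true, S₁.prod_sign, S₂.prod_sign]
      ring
    · intro u hu
      simp [hu, signCase]
  message_eq x a y := by
    rw [S₁.message_eq _ _ y.1, S₂.message_eq _ _ y.2, Fintype.sum_sum_type,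
      Fintype.sum_prod_type]
    simp only [Sum.elim_inl, Sum.elim_inr]
    rw [Fintype.sum_eq_single (α := I) y.1]
    · simp only [if_true]
      ring
    · intro u hu
      simp [hu]

/-- Interpolation of `M + 1 ≤ p` digits: all but the constant term of the polynomial are
computed by products of its coefficients with powers of Bob's input. -/
theorem nonempty_scheme_of_le [Fact p.Prime] {γ : ZMod p} {g h : ZMod p → ZMod p} {l : ℕ}
    (hγ : γ ≠ 0) (hl : IsShiftSum f l (fun x y => γ * x * y + g x + h y)) {M : ℕ}
    (hM : M + 1 ≤ p) : Nonempty (Scheme f (Fin (M + 1)) (M * l)) := by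
  obtain ⟨s, t, s', t', hl⟩ := hl
  choose c hc using fun x : Fin (M + 1) → ZMod p => exists_interpolation hM x
  have hc' : ∀ x (y : Fin (M + 1)), x y =
      c x 0 + ∑ d : Fin M, c x (d + 1) * ((y : ℕ) : ZMod p) ^ ((d : ℕ) + 1) := by
    intro x y
    rw [hc x y, Finset.sum_range_succ', pow_zero, mul_one, add_comm, Finset.sum_range]
  refine ⟨{
    ι := Fin M × (Fin l ⊕ Fin l)
    fintype := inferInstance
    decEq := inferInstance
    rank := fun _ => 0
    -- The factor `γ⁻¹` makes the product term equal to `c x (d + 1) * y ^ (d + 1)`. Of the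
    -- separable rest, Alice removes `g` in `message` and Bob removes `h` through `offset`.
    input := fun x _ k => γ⁻¹ * c x (k.1 + 1) + Sum.elim s s' k.2
    causal := fun _ _ _ _ _ => rfl
    message := fun x a => c x 0 + ∑ d : Fin M,
      (∑ k, a (d, Sum.inl k) - ∑ k, a (d, Sum.inr k) - g (γ⁻¹ * c x (d + 1)))
    bobInput := fun y k => ((y : ℕ) : ZMod p) ^ ((k.1 : ℕ) + 1) + Sum.elim t t' k.2
    sign := fun _ k => Sum.elim (fun _ => 1) (fun _ => -1) k.2
    offset := fun y => ∑ d : Fin M, h (((y : ℕ) : ZMod p) ^ ((d : ℕ) + 1))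
    prod_sign := fun y A B => by
      rw [Fintype.prod_prod_type]
      simp only [Fintype.prod_sum_type, Sum.elim_inl, Sum.elim_inr, Finset.prod_const,
        Finset.card_univ, Fintype.card_fin]
      change (A ^ l * B ^ l) ^ M = _
      ring
    message_eq := fun x a y => ?_ }⟩
  rw [hc' x y, Fintype.sum_prod_type, add_assoc, add_assoc, ← Finset.sum_add_distrib,
    ← Finset.sum_add_distrib]
  congr 1
  refine Finset.sum_congr rfl fun d _ => ?_
  have e := hl (γ⁻¹ * c x (d + 1)) (((y : ℕ) : ZMod p) ^ ((d : ℕ) + 1))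
  simp only [mul_inv_cancel_left₀ hγ] at e
  simp only [Fintype.sum_sum_type, Sum.elim_inl, Sum.elim_inr, SignType.coe_one, one_mul,
    SignType.coe_neg_one, neg_mul, Finset.sum_neg_distrib, Finset.sum_sub_distrib]
  linear_combination -e

theorem nonempty_scheme_pow {q l : ℕ} (S : Scheme f (Fin q) l) (n : ℕ) :
    Nonempty (Scheme f (Fin (q ^ n)) (n * l)) := by
  induction n with
  | zero =>
    rw [pow_zero, zero_mul]
    exact ⟨Scheme.single f⟩
  | succ n ih =>
    obtain ⟨T⟩ := ih
    rw [pow_succ, add_mul, one_mul]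
    exact ⟨(T.prod S).reindex finProdFinEquiv⟩

end Schemes

/-! ### The Fourier sum as a probability -/

theorem omega_pow_eq_stdAddChar {p : ℕ} [NeZero p] (n : ℕ) :
    omega p ^ n = ZMod.stdAddChar (n : ZMod p) := by
  have h := ZMod.stdAddChar_coe (N := p) (n : ℤ)
  rw [Int.cast_natCast] at h
  rw [h, omega, ← Complex.exp_nat_mul]
  congr 1
  push_cast
  ring

theorem sum_range_natCast_zmod {p : ℕ} [NeZero p] (F : ZMod p → ℂ) :
    ∑ k ∈ Finset.range p, F k = ∑ k : ZMod p, F k :=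
  Finset.sum_nbij' (fun k => (k : ZMod p)) ZMod.val (by simp)
    (fun k _ => Finset.mem_range.2 (ZMod.val_lt k))
    (fun _ hk => ZMod.val_cast_of_lt (Finset.mem_range.1 hk)) (by simp) (by simp)

theorem addChar_map_sum {A R ι : Type*} [AddCommMonoid A] [CommMonoid R] (ψ : AddChar A R)
    (s : Finset ι) (z : ι → A) : ψ (∑ i ∈ s, z i) = ∏ i ∈ s, ψ (z i) := by
  induction s using Finset.cons_induction with
  | empty => simp
  | cons i s hi ih => rw [Finset.sum_cons, Finset.prod_cons, AddChar.map_add_eq_mul, ih]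

/-- The law of the noise of a box that enters with sign `s`: unused boxes have no noise. -/
def noiseWeight {p : ℕ} (v : ZMod p → ℝ) (s : SignType) (j : ZMod p) : ℝ :=
  if s = 0 then (if j = 0 then 1 else 0) else v j

/-- The Fourier transform of one signed noise: sign `-1` inverts the character, and the point mass
at 0 of an unused box transforms to 1. -/
theorem signCase_eq_sum_noiseWeight {p : ℕ} [NeZero p] (v : ZMod p → ℝ) (k : ZMod p)
    (s : SignType) :
    signCase (∑ j, (v j : ℂ) * ZMod.stdAddChar (j * k))
        (∑ j, (v j : ℂ) * ZMod.stdAddChar (-(j * k))) s =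
      ∑ j, (noiseWeight v s j : ℂ) * ZMod.stdAddChar ((s : ZMod p) * j * k) := by
  cases s
  · change (1 : ℂ) = _
    have h : ∀ j : ZMod p, (noiseWeight v SignType.zero j : ℂ) = if j = 0 then 1 else 0 := by
      intro j
      change ((if j = 0 then (1 : ℝ) else 0 : ℝ) : ℂ) = _
      split_ifs <;> simp
    change _ = ∑ j, (noiseWeight v SignType.zero j : ℂ) * ZMod.stdAddChar ((0 : ZMod p) * j * k)
    simp only [h]
    simp
  · change ∑ j, (v j : ℂ) * _ = ∑ j, (v j : ℂ) * ZMod.stdAddChar ((-1 : ZMod p) * j * k)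
    simp only [neg_mul, one_mul]
  · change ∑ j, (v j : ℂ) * _ = ∑ j, (v j : ℂ) * ZMod.stdAddChar ((1 : ZMod p) * j * k)
    simp only [one_mul]

/-- Expanding the powers gives one character per noise vector, and summing over `k` leaves only the
vectors with `c + ∑ σ i * j i = 0`. In particular the sum is real. -/
theorem fourierSum_eq_sum_noiseWeight {p : ℕ} [NeZero p] {ι : Type} [Fintype ι] [DecidableEq ι]
    (v : ZMod p → ℝ) (c : ZMod p) (L : ℕ) (σ : ι → SignType)
    (hσ : ∀ A B : ℂ, ∏ i, signCase A B (σ i) = A ^ (L / 2) * B ^ (L / 2)) :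
    fourierSum v c L = ((∑ j : ι → ZMod p, if c + ∑ i, (σ i : ZMod p) * j i = 0 then
      ∏ i, noiseWeight v (σ i) (j i) else 0 : ℝ) : ℂ) := by
  have hterm : ∀ k : ℕ, omega p ^ (c.val * k)
      * (∑ j : ZMod p, (v j : ℂ) * omega p ^ (j.val * k)) ^ (L / 2)
      * (∑ j : ZMod p, (v j : ℂ) * (omega p ^ (j.val * k))⁻¹) ^ (L / 2) =
      ∑ j : ι → ZMod p, (∏ i, (noiseWeight v (σ i) (j i) : ℂ)) *
        ZMod.stdAddChar ((k : ZMod p) * (c + ∑ i, (σ i : ZMod p) * j i)) := by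
    intro k
    have h1 : ∀ j : ZMod p, omega p ^ (j.val * k) = ZMod.stdAddChar (j * (k : ZMod p)) := by
      intro j
      rw [omega_pow_eq_stdAddChar, Nat.cast_mul, ZMod.natCast_zmod_val]
    simp only [h1, ← AddChar.map_neg_eq_inv]
    rw [mul_assoc, ← hσ]
    simp only [signCase_eq_sum_noiseWeight]
    rw [Finset.prod_univ_sum, Fintype.piFinset_univ, Finset.mul_sum]
    refine Finset.sum_congr rfl fun j _ => ?_
    rw [Finset.prod_mul_distrib, ← addChar_map_sum, mul_left_comm,
      ← AddChar.map_add_eq_mul, ← Finset.sum_mul]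
    congr 2
    ring
  simp only [fourierSum, hterm]
  rw [sum_range_natCast_zmod (fun k => ∑ j : ι → ZMod p,
    (∏ i, (noiseWeight v (σ i) (j i) : ℂ)) *
      ZMod.stdAddChar (k * (c + ∑ i, (σ i : ZMod p) * j i))), Finset.sum_comm, Finset.mul_sum]
  push_cast
  refine Finset.sum_congr rfl fun j _ => ?_
  rw [← Finset.mul_sum, AddChar.sum_mulShift _ (ZMod.isPrimitive_stdAddChar p), ZMod.card]
  have hp : (p : ℂ) ≠ 0 := NeZero.ne _
  split_ifs
  · push_cast
    field_simp
  · simp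

/-! ### Consequences of information causality -/

section Protocols
variable {p : ℕ} [NeZero p]

/-- The indicator is spread over the coordinates as a product, so the sum factorises; this is the
uniform marginal of `x i`. -/
theorem sum_ite_apply_eq {N : ℕ} (i : Fin N) (u : ZMod p) :
    ∑ x : Fin N → ZMod p, (if x i = u then ((p : ℝ) ^ N)⁻¹ else 0) = (p : ℝ)⁻¹ := by
  have hp : (p : ℝ) ≠ 0 := NeZero.ne _
  have h : ∀ x : Fin N → ZMod p, (if x i = u then ((p : ℝ) ^ N)⁻¹ else 0) =
      ∏ k, if k = i ∧ x k ≠ u then 0 else (p : ℝ)⁻¹ := by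
    intro x
    split_ifs with hx
    · rw [Finset.prod_congr rfl fun k _ => if_neg ?_]
      · simp
      · rintro ⟨rfl, h⟩
        exact h hx
    · refine (Finset.prod_eq_zero (Finset.mem_univ i) ?_).symm
      rw [if_pos ⟨rfl, hx⟩]
  simp only [h]
  have h2 := (Finset.prod_univ_sum (fun _ : Fin N => (Finset.univ : Finset (ZMod p)))
    (fun k v => if k = i ∧ v ≠ u then 0 else (p : ℝ)⁻¹)).symm
  rw [Fintype.piFinset_univ] at h2
  rw [h2]
  have h3 : ∀ k, ∑ v : ZMod p, (if k = i ∧ v ≠ u then 0 else (p : ℝ)⁻¹) =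
      if k = i then (p : ℝ)⁻¹ else 1 := by
    intro k
    split_ifs with hk
    · simp [hk]
    · simp [hk, hp]
  simp [h3]

/-- If a protocol with a one-digit message always finds Alice's digit with probability at
least `q`, then information causality bounds `q`. -/
theorem InformationCausality.le_hpInv {P : Box p} (hIC : InformationCausality P) (h2 : 2 ≤ p)
    {N : ℕ} (hN : 1 ≤ N) {Ω ι : Type} [Fintype Ω] [Fintype ι] [DecidableEq ι]
    (S : Protocol p N 1 Ω ι) (h0 : ∀ x y g, 0 ≤ S.outputProb P x y g)
    (h1 : ∀ x y, ∑ g, S.outputProb P x y g = 1) {q : ℝ}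
    (hq : ∀ x y, q ≤ S.outputProb P x y (x y)) :
    q ≤ hpInv p (((N : ℝ) - 1) / N * Real.log p) := by
  have hp2 : (2 : ℝ) ≤ p := by exact_mod_cast h2
  have hN1 : (1 : ℝ) ≤ N := by exact_mod_cast hN
  have hlog : 0 ≤ Real.log p := Real.log_nonneg (by linarith)
  have hp0 : (0 : ℝ) ≤ ((p : ℝ) ^ N)⁻¹ := by positivity
  set τ := ((N : ℝ) - 1) / N * Real.log p with hτ
  have hτmem : τ ∈ Set.Icc 0 (Real.log p) := by
    refine ⟨mul_nonneg (div_nonneg (by linarith) (by linarith)) hlog,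
      mul_le_of_le_one_left hlog ?_⟩
    rw [div_le_one (by linarith)]
    linarith
  obtain ⟨hanti, hbij⟩ := hp_bijOn h2
  have hmem : hpInv p τ ∈ Set.Icc (1 / (p : ℝ)) 1 :=
    Function.invFunOn_mem (hbij.surjOn hτmem)
  have hval : hp p (hpInv p τ) = τ := Function.invFunOn_eq (hbij.surjOn hτmem)
  have hJ0 : ∀ i u g, 0 ≤ S.jointProb P i u g := by
    intro i u g
    refine Finset.sum_nonneg fun x _ => ?_
    split_ifs
    · exact mul_nonneg hp0 (h0 _ _ _)
    · exact le_rfl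
  have hJ1 : ∀ i u, ∑ g, S.jointProb P i u g = (p : ℝ)⁻¹ := by
    intro i u
    rw [← sum_ite_apply_eq i u]
    simp only [Protocol.jointProb]
    rw [Finset.sum_comm]
    refine Finset.sum_congr rfl fun x _ => ?_
    split_ifs
    · rw [← Finset.mul_sum, h1, mul_one]
    · simp
  have hdiag : ∀ i, ∑ u, S.jointProb P i u u =
      ∑ x : Fin N → ZMod p, ((p : ℝ) ^ N)⁻¹ * S.outputProb P x i (x i) := by
    intro i
    simp only [Protocol.jointProb]
    rw [Finset.sum_comm]
    exact Finset.sum_congr rfl fun x _ => by simp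
  have hcard : ∑ _x : Fin N → ZMod p, ((p : ℝ) ^ N)⁻¹ = 1 := by
    simp only [Finset.sum_const, Finset.card_univ, Fintype.card_fun, ZMod.card, Fintype.card_fin,
      nsmul_eq_mul, Nat.cast_pow]
    exact mul_inv_cancel₀ (by positivity)
  have hs1 : ∀ i, ∑ u, S.jointProb P i u u ≤ 1 := by
    intro i
    rw [hdiag, ← hcard]
    refine Finset.sum_le_sum fun x _ => mul_le_of_le_one_right hp0 ?_
    rw [← h1 x i]
    exact Finset.single_le_sum (fun g _ => h0 x i g) (Finset.mem_univ (x i))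
  have hsq : ∀ i, q ≤ ∑ u, S.jointProb P i u u := by
    intro i
    rw [hdiag]
    calc q = ∑ _x : Fin N → ZMod p, ((p : ℝ) ^ N)⁻¹ * q := by
          rw [← Finset.sum_mul, hcard, one_mul]
      _ ≤ _ := Finset.sum_le_sum fun x _ => mul_le_mul_of_nonneg_left (hq x i) hp0
  -- The success probabilities then exceed `hpInv p τ ≥ 1 / p`, so they lie on the decreasing
  -- branch; `q` itself need not be located.
  by_contra! hlt
  have hinfo : ∀ i, Real.log p - τ < mutualInfo (S.jointProb P i) := by
    intro i
    have hb := hlt.trans_le (hsq i)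
    have h3 := hanti hmem ⟨hmem.1.trans hb.le, hs1 i⟩ hb
    rw [hval] at h3
    linarith [log_sub_hp_le_mutualInfo h2 (S.jointProb P i) (hJ0 i) (hJ1 i)]
  have hsum : ∑ _i : Fin N, (Real.log p - τ) < ∑ i : Fin N, mutualInfo (S.jointProb P i) :=
    Finset.sum_lt_sum_of_nonempty ⟨⟨0, hN⟩, Finset.mem_univ _⟩ fun i _ => hinfo i
  have hle := hIC N 1 Ω ι S
  -- The value `τ` is chosen so that `N` times the deficit `log p - τ` equals the capacity of one
  -- digit.
  have heq : ∑ _i : Fin N, (Real.log p - τ) = Real.log p := by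
    rw [Finset.sum_const, Finset.card_univ, Fintype.card_fin, nsmul_eq_mul, hτ]
    field_simp
    ring
  rw [heq] at hsum
  rw [Nat.cast_one, one_mul] at hle
  linarith

theorem nu_nonneg (P : Box p) (f : ZMod p → ZMod p → ZMod p) (j : ZMod p) : 0 ≤ nu P f j :=
  Finset.le_inf' _ _ fun _ _ => Finset.sum_nonneg fun _ _ => P.prob_nonneg _ _ _ _

theorem nu_le_shiftProb (P : Box p) (f : ZMod p → ZMod p → ZMod p) (x y j : ZMod p) :
    nu P f j ≤ shiftProb P f x y j :=
  Finset.inf'_le (fun xy : ZMod p × ZMod p => shiftProb P f xy.1 xy.2 j) (Finset.mem_univ (x, y))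

/-- The noise of a box that enters with sign `s`. -/
def noise (f : ZMod p → ZMod p → ZMod p) (s : SignType) (x y a b : ZMod p) : ZMod p :=
  if s = 0 then 0 else f x y - (a - b)

theorem noiseWeight_nu_le (P : Box p) (f : ZMod p → ZMod p → ZMod p) (s : SignType)
    (x y j : ZMod p) :
    noiseWeight (nu P f) s j ≤
      ∑ a, ∑ b, if noise f s x y a b = j then P.prob a b x y else 0 := by
  by_cases hs : s = 0
  · simp only [noiseWeight, noise, hs, if_true]
    by_cases hj : j = 0
    · simp [hj, P.sum_prob]
    · simp [hj, Ne.symm hj]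
  · simp only [noiseWeight, noise, hs, if_false]
    refine (nu_le_shiftProb P f x y j).trans (Finset.sum_le_sum fun a _ => ?_)
    have h : f x y - (a - (a - f x y + j)) = j := by ring
    calc P.prob a (a - f x y + j) x y
        = if f x y - (a - (a - f x y + j)) = j then P.prob a (a - f x y + j) x y else 0 := by
          rw [if_pos h]
      _ ≤ _ := Finset.single_le_sum (f := fun b =>
          if f x y - (a - b) = j then P.prob a b x y else 0) (fun b _ => by
            split_ifs
            · exact P.prob_nonneg _ _ _ _
            · exact le_rfl) (Finset.mem_univ (a - f x y + j))

/-- Information causality bounds the success probability of every scheme. -/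
theorem Scheme.fourierSum_le {P : Box p} (hIC : InformationCausality P) (h2 : 2 ≤ p)
    {f : ZMod p → ZMod p → ZMod p} {N l L : ℕ} (S : Scheme f (Fin N) l) (hN : 1 ≤ N)
    (hL : L / 2 = l) (c : ZMod p) :
    (fourierSum (nu P f) c L).im = 0 ∧
      (fourierSum (nu P f) c L).re ≤ hpInv p (((N : ℝ) - 1) / N * Real.log p) := by
  subst hL
  -- The left side does not involve `y`: only the numbers of signs matter, so one bound serves all
  -- of Bob's inputs.
  have hF := fun y => fourierSum_eq_sum_noiseWeight (nu P f) c L (S.sign y) (S.prod_sign y)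
  refine ⟨by rw [hF ⟨0, hN⟩, Complex.ofReal_im], ?_⟩
  choose T hT hTi using fun x => Strategy.exists_inputs_eq S.rank (S.input x) (S.causal x)
  choose B hB hBi using fun y => Strategy.exists_inputs_eq (fun _ => 0)
    (fun _ : S.ι → ZMod p => S.bobInput y) (fun _ _ _ _ => rfl)
  let Q : Protocol p N 1 Unit S.ι :=
    { weight := fun _ => 1
      weight_nonneg := fun _ => zero_le_one
      sum_weight := by simp
      alice := fun _ x => T x
      alice_valid := fun _ x => hT x
      message := fun _ x a _ => S.message x a
      bob := fun _ y _ => B y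
      bob_valid := fun _ y _ => hB y
      -- By `message_eq` this is `x y - c - ∑ σ i * noise i`, so the guess is right exactly when `c
      -- + ∑ σ i * noise i = 0`.
      guess := fun _ y q b => q 0 - S.offset y - ∑ i, (S.sign y i : ZMod p) * b i - c }
  have hout : ∀ x y g, Q.outputProb P x y g = ∑ a : S.ι → ZMod p, ∑ b : S.ι → ZMod p,
      if S.message x a - S.offset y - ∑ i, (S.sign y i : ZMod p) * b i - c = g then
        ∏ i, P.prob (a i) (b i) ((T x).inputs a i) (S.bobInput y i) else 0 := by
    intro x y g
    simp [Protocol.outputProb, Q, hBi]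
  have hprob : ∀ x y (a b : S.ι → ZMod p),
      0 ≤ ∏ i, P.prob (a i) (b i) ((T x).inputs a i) (S.bobInput y i) :=
    fun _ _ _ _ => Finset.prod_nonneg fun _ _ => P.prob_nonneg _ _ _ _
  refine hIC.le_hpInv h2 hN Q ?_ ?_ ?_
  · intro x y g
    rw [hout]
    refine Finset.sum_nonneg fun a _ => Finset.sum_nonneg fun b _ => ?_
    split_ifs
    · exact hprob x y a b
    · exact le_rfl
  · intro x y
    simp only [hout]
    rw [Finset.sum_comm, ← Strategy.sum_runs_eq_one P (T x) (S.bobInput y)]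
    refine Finset.sum_congr rfl fun a _ => ?_
    rw [Finset.sum_comm]
    simp
  · intro x y
    rw [hF y, Complex.ofReal_re, hout]
    refine (Strategy.le_sum_runs P (T x) (S.bobInput y)
      (fun i x' => noise f (S.sign y i) x' (S.bobInput y i))
      (fun i => noiseWeight (nu P f) (S.sign y i)) ?_
      (fun i x' j => noiseWeight_nu_le P f _ x' _ j)
      (fun j => c + ∑ i, (S.sign y i : ZMod p) * j i = 0)).trans_eq ?_
    · intro i j
      simp only [noiseWeight]
      split_ifs
      · exact zero_le_one
      · exact le_rfl
      · exact nu_nonneg P f j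
    · refine Finset.sum_congr rfl fun a _ => Finset.sum_congr rfl fun b _ => ?_
      refine if_congr ?_ rfl rfl
      have hnoise : ∀ i, (S.sign y i : ZMod p) *
          noise f (S.sign y i) ((T x).inputs a i) (S.bobInput y i) (a i) (b i) =
          (S.sign y i : ZMod p) * b i -
            (S.sign y i : ZMod p) * (a i - f (S.input x a i) (S.bobInput y i)) := by
        intro i
        rw [hTi]
        by_cases hs : S.sign y i = 0
        · simp [hs]
        · simp only [noise, hs, if_false]
          ring
      simp only [hnoise, Finset.sum_sub_distrib, S.message_eq x a y]
      constructor
      · intro h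
        linear_combination -h
      · intro h
        linear_combination -h

end Protocols

end FunctionalBox

/-! ### The two cases: interpolation, and its `n`-fold nesting. -/

theorem theorem5 (p : ℕ) [Fact p.Prime] (P : Box p) (hIC : InformationCausality P)
    (f : ZMod p → ZMod p → ZMod p) (hf : ¬ AdditivelySeparable f) (hDelta : 2 < Delta f) :
    (∀ N L : ℕ, 1 ≤ N → N ≤ p → L = (N - 1) * 2 ^ (Delta f - 2) → ∀ c : ZMod p,
      (fourierSum (nu P f) c L).im = 0 ∧
      (fourierSum (nu P f) c L).re ≤ hpInv p (((N : ℝ) - 1) / N * Real.log p)) ∧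
    (∀ n N L : ℕ, 1 ≤ n → N = p ^ n → L = n * (p - 1) * 2 ^ (Delta f - 2) → ∀ c : ZMod p,
      (fourierSum (nu P f) c L).im = 0 ∧
      (fourierSum (nu P f) c L).re ≤ hpInv p (((N : ℝ) - 1) / N * Real.log p)) := by
  have h2 : 2 ≤ p := (Fact.out : p.Prime).two_le
  obtain ⟨γ, g, h, hγ, hl⟩ := exists_isShiftSum_mul f hDelta
  have hpow : 2 ^ (Delta f - 2) = 2 ^ (Delta f - 3) * 2 := by
    rw [← pow_succ]
    congr 1
    omega
  -- Each product needs `2 ^ (Δ - 3)` boxes of each sign, which is half of its share of `L`.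
  have hhalf : ∀ M, M * 2 ^ (Delta f - 2) / 2 = M * 2 ^ (Delta f - 3) := fun M => by
    rw [hpow, ← mul_assoc, Nat.mul_div_cancel _ two_pos]
  constructor
  · rintro N L hN hNp rfl c
    obtain ⟨M, rfl⟩ := Nat.exists_eq_add_of_le' hN
    obtain ⟨S⟩ := nonempty_scheme_of_le hγ hl hNp
    exact S.fourierSum_le hIC h2 hN (hhalf _) c
  · rintro n N L - rfl rfl c
    obtain ⟨M, hM⟩ := Nat.exists_eq_add_of_le' (one_le_two.trans h2)
    obtain ⟨S⟩ := nonempty_scheme_of_le hγ hl hM.ge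
    rw [← hM] at S
    obtain ⟨T⟩ := nonempty_scheme_pow S n
    refine T.fourierSum_le hIC h2 (Nat.one_le_pow _ _ (by omega)) ?_ c
    rw [hhalf, mul_assoc, show M = p - 1 by omega]
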